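/- Let $K$ be a field, let $n \ge 2$, and let $M_n$ be the ideal of $K[x,y,z]=K[x_1,\dots,x_n,y_1,\dots,y_n,z_1,\dots,z_n]$ generated by all monomials $x_ix_j$, $x_iy_jy_k$ and $y_iy_jy_ky_l$, where $i,j,k,l$ run over distinct indices in $\{1,\dots,n\}$. Let $\Delta_n$ be the Stanley–Reisner complex of $M_n$, that is, the simplicial complex on the set of the $3n$ variables whose facets are the complements of those sets of variables that generate a minimal prime of $M_n$. Write $p_{1j}=x_j$, $p_{2j}=y_j$, $p_{3j}=z_j$. Let $U_n$ be the set of vectors $u\in\{0,1,2\}^n$ that have either three coordinates equal to $1$ and all others equal to $2$, or one coordinate equal to $0$, one coordinate equal to $1$ and all others equal to $2$. For $u \in U_n$ put $F_u=\{p_{ij} : u_j< i\le 3,\ 1\le j\le n\}$. Then the sets $F_u$, $u\in U_n$, are pairwise distinct and are exactly the facets of $\Delta_n$, and listing them in increasing lexicographic order of $u$ gives a shelling of $\Delta_n$: the complex is pure (all facets have the same cardinality), and for each $u \in U_n$ other than the lexicographically first one, there is a unique minimal face among the faces of $F_u$ that are not faces of any $F_{u'}$ with $u'\in U_n$ lexicographically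 smaller than $u$. In particular, $\Delta_n$ is shellable. Moreover, the quotient ring $K[x,y,z]/M_n$ is Cohen–Macaulay. -/

import Mathlib

/-! ### Simplicial complexes and shellings

A simplicial complex on the vertex set `V` is a family of finite subsets of `V`, its faces, closed
under passing to subsets, i.e. a `LowerSet (Finset V)`. The empty set is a face of every complex
that has a face at all, as is customary in combinatorial commutative algebra. -/

/-- The facets of a simplicial complex: its inclusion-maximal faces. -/
def simplicialFacets {V : Type*} (Δ : LowerSet (Finset V)) : Set (Finset V) :=
  {G | Maximal (fun H => H ∈ Δ) G}

/-- The family `F`, indexed by the linearly ordered set `ι`, is a shelling of the simplicial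
complex `Δ`: it lists each facet of `Δ` exactly once, the complex is pure, and for every `j` that
is not the first index there is a unique minimal face of `F j` among the faces of `F j` that are
not faces of an earlier facet `F i`, `i < j`. -/
structure IsShelling {V ι : Type*} [LinearOrder ι] (Δ : LowerSet (Finset V))
    (F : ι → Finset V) : Prop where
  injective : Function.Injective F
  range_eq : Set.range F = simplicialFacets Δ
  pure : ∀ i j : ι, (F i).card = (F j).card
  existsUnique_minimal : ∀ j : ι, (∃ i, i < j) →
    ∃! G : Finset V, Minimal (fun H => H ⊆ F j ∧ ∀ i, i < j → ¬ H ⊆ F i) G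

/-- A simplicial complex is shellable if its facets can be ordered as a shelling
`F₁, …, F_q`. -/
def IsShellable {V : Type*} (Δ : LowerSet (Finset V)) : Prop :=
  ∃ (q : ℕ) (F : Fin q → Finset V), IsShelling Δ F

/-- The Stanley–Reisner complex of a (squarefree monomial) ideal `I` of the polynomial ring over
`K` with variables indexed by the finite set `V`: the simplicial complex on `V` generated by the
complements `V \ S` of those `S ⊆ V` for which the prime `⟨X v : v ∈ S⟩` is a minimal prime
of `I`. -/
def stanleyReisnerComplex {K V : Type*} [Field K] [Fintype V] [DecidableEq V]
    (I : Ideal (MvPolynomial V K)) : LowerSet (Finset V) where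
  carrier := {G | ∃ S : Finset V,
    Ideal.span ((fun v => (MvPolynomial.X v : MvPolynomial V K)) '' (S : Set V)) ∈ I.minimalPrimes ∧
      G ⊆ Sᶜ}
  lower' := fun _ _ hle h => h.imp fun _ hS => ⟨hS.1, hle.trans hS.2⟩

/-! ### Cohen–Macaulay rings -/

/-- The depth of a local ring: the supremum of the lengths of the regular sequences in its
maximal ideal. -/
noncomputable def localRingDepth (R : Type*) [CommRing R] [IsLocalRing R] : ℕ∞ :=
  ⨆ rs : {rs : List R // (∀ r ∈ rs, r ∈ IsLocalRing.maximalIdeal R) ∧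
    RingTheory.Sequence.IsRegular R rs}, (rs.1.length : ℕ∞)

/-- A Noetherian ring is Cohen–Macaulay if the localization at each maximal ideal is a local ring
whose depth equals its Krull dimension. -/
def IsCohenMacaulayRing (R : Type*) [CommRing R] : Prop :=
  IsNoetherianRing R ∧ ∀ (m : Ideal R) [m.IsMaximal],
    (localRingDepth (Localization.AtPrime m) : WithBot ℕ∞) =
      ringKrullDim (Localization.AtPrime m)

/-! ### The generic initial ideal `M_n` and the sets `F_u`

The variables of `K[x, y, z] = K[x₁, …, x_n, y₁, …, y_n, z₁, …, z_n]` are indexed by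
`Fin 3 × Fin n`, where the first component selects the letter: `x`, `y`, `z` are `0`, `1`, `2`. -/

/-- The variable `x_j`. -/
noncomputable def xVar (K : Type*) [Field K] {n : ℕ} (j : Fin n) :
    MvPolynomial (Fin 3 × Fin n) K :=
  MvPolynomial.X (0, j)

/-- The variable `y_j`. -/
noncomputable def yVar (K : Type*) [Field K] {n : ℕ} (j : Fin n) :
    MvPolynomial (Fin 3 × Fin n) K :=
  MvPolynomial.X (1, j)

/-- The ideal `M_n` of `K[x, y, z]` generated by all `x_i x_j`, `x_i y_j y_k` and
`y_i y_j y_k y_l` with distinct indices. -/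
noncomputable def genericInitialIdeal (K : Type*) [Field K] (n : ℕ) :
    Ideal (MvPolynomial (Fin 3 × Fin n) K) :=
  Ideal.span
    ({p | ∃ i j : Fin n, i ≠ j ∧ p = xVar K i * xVar K j} ∪
     {p | ∃ i j k : Fin n, i ≠ j ∧ i ≠ k ∧ j ≠ k ∧ p = xVar K i * yVar K j * yVar K k} ∪
     {p | ∃ i j k l : Fin n, i ≠ j ∧ i ≠ k ∧ i ≠ l ∧ j ≠ k ∧ j ≠ l ∧ k ≠ l ∧
        p = yVar K i * yVar K j * yVar K k * yVar K l})

/-- The vectors `u ∈ {0,1,2}ⁿ` that have three coordinates equal to one and all others equal to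
two, or one coordinate equal to zero, one equal to one and all others equal to two. -/
def IsFacetVector {n : ℕ} (u : Fin n → Fin 3) : Prop :=
  (∃ i j k : Fin n, i ≠ j ∧ i ≠ k ∧ j ≠ k ∧ u i = 1 ∧ u j = 1 ∧ u k = 1 ∧
    ∀ l, l ≠ i → l ≠ j → l ≠ k → u l = 2) ∨
  (∃ i j : Fin n, i ≠ j ∧ u i = 0 ∧ u j = 1 ∧ ∀ l, l ≠ i → l ≠ j → u l = 2)

/-- The set of these vectors, linearly ordered by the lexicographic order: `u < v` if `u j < v j`
at the first index `j` where they differ. -/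
abbrev FacetIndex (n : ℕ) : Type :=
  {u : Lex (Fin n → Fin 3) // IsFacetVector (ofLex u)}

/-- `F_u`: the set of the variables `p_{ij}` with `u_j < i ≤ 3`, where `p_{1j}, p_{2j}, p_{3j}` are
`x_j, y_j, z_j`. Here rows are counted from `0`, so the condition on the row reads `u_j ≤ i`. -/
def facetSet {n : ℕ} (u : Fin n → Fin 3) : Finset (Fin 3 × Fin n) :=
  Finset.univ.filter fun p => u p.2 ≤ p.1

-- Measure `u` by its deficit, the sum over `j` of `2 - u j`: the vectors in question are exactly
-- those of deficit 3, since 3 is 1+1+1 or 2+1. A generator of `M_n` needs deficit 4 (an `x` costs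
-- 2, a `y` costs 1), so a set of variables fits into some `F_u` iff it contains no generator
-- (`notMem_facetComplex_iff`). Hence `M_n` is the face ideal of the complex of the `F_u`, and
-- purity is a count by columns.
--
-- The lexicographic order shells because deficit can be moved: if `u k ≤ 1` and some `j < k` has `u
-- j > 0`, then lowering `u j` and raising `u k` by one gives an earlier facet vector whose set
-- contains all of `F_u` except the variable in row `u k` of column `k`. These variables form the
-- restriction of `F_u` (`facetRestriction_subset_iff`).
--
-- Cohen–Macaulayness holds for every shelling. Adding a facet `F` with restriction `G` gives an
-- exact sequence `0 → R/P_F → R/I_{k+1} → R/I_k → 0`, the first map being multiplication by the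
-- monomial of `G`. As `R/P_F` is a polynomial ring in `d = |F|` variables, `Ext^i(R/m, -)` vanishes
-- on it for `i < d`, hence on all `R/I_k`. Rees's theorem turns this vanishing into a regular
-- sequence of length `d` in `m`, and the dimension is at most `d`.

universe w

/-! ### Regular sequences of one-variable polynomials -/

section WeaklyRegular

open RingTheory.Sequence

/-- A monic polynomial over `C`, followed by a weakly regular sequence of `C`, is weakly regular in
the polynomial ring: modulo the polynomial, `C[X]` is free over `C`. -/
theorem Polynomial.Monic.isWeaklyRegular_cons_map_C {C : Type*} [CommRing C] {g : Polynomial C}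
    (hg : g.Monic) {rs : List C} (hrs : IsWeaklyRegular C rs) :
    IsWeaklyRegular (Polynomial C) (g :: rs.map Polynomial.C) := by
  refine IsWeaklyRegular.cons (fun a b hab => hg.isRegular.left hab) ?_
  have : Module.Free C (AdjoinRoot g) := hg.free_adjoinRoot
  have h1 : IsWeaklyRegular (AdjoinRoot g) (rs.map (algebraMap C (AdjoinRoot g))) :=
    IsWeaklyRegular.of_flat hrs
  have h2 : IsWeaklyRegular (Polynomial C ⧸ Ideal.span {g}) (rs.map Polynomial.C) := by
    rw [← isWeaklyRegular_map_algebraMap_iff (R := Polynomial C)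
      (S := Polynomial C ⧸ Ideal.span {g}), List.map_map]
    exact h1
  refine ((Submodule.quotEquivOfEq _ _ ?_).isWeaklyRegular_congr _).mp h2
  rw [← Submodule.ideal_span_singleton_smul, smul_eq_mul, Ideal.mul_top]

theorem RingEquiv.isWeaklyRegular_map_iff {R S : Type*} [CommRing R] [CommRing S] (e : R ≃+* S)
    (rs : List R) : IsWeaklyRegular S (rs.map e) ↔ IsWeaklyRegular R rs :=
  (AddEquiv.isWeaklyRegular_congr (e := e.toAddEquiv) <| List.forall₂_map_right_iff.mpr <|
    List.forall₂_same.mpr fun r _ x => map_mul e r x).symm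

/-- Monic polynomials in pairwise distinct variables form a weakly regular sequence. -/
theorem MvPolynomial.isWeaklyRegular_ofFn_aeval_X {K : Type*} [CommRing K] (m : ℕ)
    (g : Fin m → Polynomial K) (hg : ∀ i, (g i).Monic) :
    IsWeaklyRegular (MvPolynomial (Fin m) K)
      (List.ofFn fun i => Polynomial.aeval (MvPolynomial.X i : MvPolynomial (Fin m) K) (g i)) := by
  induction m with
  | zero => simp
  | succ m ih =>
    have h := ((hg 0).map (algebraMap K (MvPolynomial (Fin m) K))).isWeaklyRegular_cons_map_C
      (ih (fun i => g i.succ) fun i => hg _)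
    -- Variable 0 becomes the polynomial variable over the ring in the other variables.
    rw [← RingEquiv.isWeaklyRegular_map_iff (MvPolynomial.finSuccEquiv K m).toRingEquiv]
    have key (j : Fin (m + 1)) (p : Polynomial K) :
        (MvPolynomial.finSuccEquiv K m).toRingEquiv (Polynomial.aeval (MvPolynomial.X j) p) =
          Polynomial.aeval (MvPolynomial.finSuccEquiv K m (MvPolynomial.X j)) p :=
      (Polynomial.aeval_algHom_apply (MvPolynomial.finSuccEquiv K m).toAlgHom _ _).symm
    convert h using 1
    rw [List.ofFn_succ, List.map_cons, List.map_ofFn, List.map_ofFn, key,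
      MvPolynomial.finSuccEquiv_X_zero]
    congr 1
    congr 1
    ext1 i
    simp only [Function.comp_apply, key, MvPolynomial.finSuccEquiv_X_succ]
    exact Polynomial.aeval_algHom_apply
      (IsScalarTower.toAlgHom K (MvPolynomial (Fin m) K) (Polynomial (MvPolynomial (Fin m) K))) _ _

theorem MvPolynomial.isWeaklyRegular_map_aeval_X {K V : Type*} [CommRing K] (l : List V)
    (hl : l.Nodup) (hV : ∀ v, v ∈ l) (g : V → Polynomial K) (hg : ∀ v, (g v).Monic) :
    IsWeaklyRegular (MvPolynomial V K)
      (l.map fun v => Polynomial.aeval (MvPolynomial.X v : MvPolynomial V K) (g v)) := by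
  classical
  let e := hl.getEquivOfForallMemList l hV
  have h := MvPolynomial.isWeaklyRegular_ofFn_aeval_X l.length (fun i => g (l.get i)) fun i => hg _
  rw [← RingEquiv.isWeaklyRegular_map_iff (MvPolynomial.renameEquiv K e).toRingEquiv] at h
  have key (i : Fin l.length) (p : Polynomial K) :
      (MvPolynomial.renameEquiv K e).toRingEquiv (Polynomial.aeval (MvPolynomial.X i) p) =
        Polynomial.aeval (MvPolynomial.X (l.get i)) p := by
    refine (Polynomial.aeval_algHom_apply (MvPolynomial.renameEquiv K e).toAlgHom _ _).symm.trans ?_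
    congr 2
    exact MvPolynomial.rename_X _ _
  rw [List.map_ofFn] at h
  rw [← List.ofFn_get l, List.map_ofFn]
  simpa only [Function.comp_def, key] using h

/-- Monic polynomials in the variables in `F` form a weakly regular sequence on the quotient by the
variables outside of `F`. -/
theorem MvPolynomial.isWeaklyRegular_quotient_span_X {K V : Type*} [CommRing K] [Fintype V]
    [DecidableEq V] (F : Finset V) (g : V → Polynomial K) (hg : ∀ v, (g v).Monic) :
    IsWeaklyRegular (MvPolynomial V K ⧸ Ideal.span
        ((fun v => (MvPolynomial.X v : MvPolynomial V K)) '' ((Fᶜ : Finset V) : Set V)))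
      (F.toList.map fun v => Polynomial.aeval (MvPolynomial.X v : MvPolynomial V K) (g v)) := by
  -- List the variables outside `F` first, each with the polynomial `X`; the tail of this sequence
  -- is then weakly regular modulo them.
  have h := MvPolynomial.isWeaklyRegular_map_aeval_X (Fᶜ.toList ++ F.toList)
    (List.nodup_append.mpr ⟨Finset.nodup_toList _, Finset.nodup_toList _, fun a ha b hb => by
      rintro rfl
      simp only [Finset.mem_toList, Finset.mem_compl] at ha hb
      exact ha hb⟩) (fun v => by simp [em']) (fun v => if v ∈ F then g v else Polynomial.X)
    (fun v => by
      split_ifs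
      exacts [hg v, Polynomial.monic_X])
  rw [List.map_append, isWeaklyRegular_append_iff] at h
  have h2 : F.toList.map (fun v => Polynomial.aeval (MvPolynomial.X v : MvPolynomial V K)
      (if v ∈ F then g v else Polynomial.X)) =
      F.toList.map fun v => Polynomial.aeval (MvPolynomial.X v : MvPolynomial V K) (g v) :=
    List.map_congr_left fun v hv => by rw [if_pos (Finset.mem_toList.mp hv)]
  rw [h2] at h
  refine ((Submodule.quotEquivOfEq _ _ ?_).isWeaklyRegular_congr _).mp h.2
  rw [smul_eq_mul, Ideal.mul_top, Ideal.ofList]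
  congr 1
  ext p
  simp only [List.mem_map, Finset.mem_toList, Set.mem_ofPred_eq, Set.mem_image, Finset.mem_coe]
  refine exists_congr fun v => and_congr_right fun hv => ?_
  rw [if_neg (Finset.mem_compl.mp hv), Polynomial.aeval_X]

end WeaklyRegular

/-! ### Vanishing of Ext -/

section Ext

open CategoryTheory Abelian RingTheory.Sequence IsSMulRegular LinearMap Limits

/-- The `Ext` groups from a module supported on the zero locus of `I` to a module with a weakly
regular sequence in `I` vanish below the length of the sequence. -/
theorem ModuleCat.subsingleton_ext_of_isWeaklyRegular {R : Type w} [CommRing R]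
    (I : Ideal R) (N : ModuleCat.{w} R) (hN : I ≤ Module.annihilator R N)
    (M : ModuleCat.{w} R) (rs : List R) (mem : ∀ r ∈ rs, r ∈ I) (reg : IsWeaklyRegular M rs) :
    ∀ i < rs.length, Subsingleton (Ext N M i) := by
  induction rs generalizing M with
  | nil => simp
  | cons a rs ih =>
    rw [isWeaklyRegular_cons_iff] at reg
    have ha : a ∈ Module.annihilator R N := hN (mem a List.mem_cons_self)
    rintro (_ | i) hi
    -- A map from `N` to `M` is zero: `a` kills `N` but is a nonzerodivisor on `M`.
    · have : Subsingleton (N →ₗ[R] M) := linearMap_subsingleton_of_mem_annihilator reg.1 ha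
      exact (Ext.addEquiv₀.trans ModuleCat.homAddEquiv).subsingleton
    -- Multiplication by `a` on `Ext N M (i + 1)` is injective, as `Ext N (M/aM) i = 0`, and it is
    -- zero, as `a` kills `N`.
    · have hmono : Mono (AddCommGrpCat.ofHom
          ((Ext.mk₀ (smulShortComplex M a).f).postcomp N (add_zero (i + 1)))) := by
        apply (Ext.covariant_sequence_exact₁' N reg.1.smulShortComplex_shortExact i (i + 1)
          rfl).mono_g ((AddCommGrpCat.isZero_of_iff_subsingleton.mpr ?_).eq_zero_of_src _)
        exact ih (ModuleCat.of R (QuotSMulTop a M)) (fun r hr => mem r (List.mem_cons_of_mem _ hr))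
          reg.2 i (by simpa using hi)
      rw [smulShortComplex_f_eq_smul_id] at hmono
      exact AddCommGrpCat.subsingleton_of_isZero (@IsZero.of_mono_eq_zero _ _ _ _ _ _ hmono
        (Ext.postcomp_smul_id_eq_zero_of_mem_annihilator ha (i + 1)))

/-- Vanishing of `Ext` is inherited by the middle term of a short exact sequence. -/
theorem ModuleCat.subsingleton_ext_of_exact {R : Type w} [CommRing R] (N : ModuleCat.{w} R)
    {M₁ M₂ M₃ : Type w} [AddCommGroup M₁] [AddCommGroup M₂] [AddCommGroup M₃]
    [Module R M₁] [Module R M₂] [Module R M₃] (f : M₁ →ₗ[R] M₂) (g : M₂ →ₗ[R] M₃)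
    (hf : Function.Injective f) (hg : Function.Surjective g) (hfg : Function.Exact f g) (i : ℕ)
    (h₁ : Subsingleton (Ext N (ModuleCat.of R M₁) i))
    (h₃ : Subsingleton (Ext N (ModuleCat.of R M₃) i)) :
    Subsingleton (Ext N (ModuleCat.of R M₂) i) := by
  let S := ModuleCat.shortComplexOfCompEqZero f g hfg.linearMap_comp_eq_zero
  have hS : S.ShortExact :=
    { exact := ModuleCat.shortComplex_exact _ hfg
      mono_f := (ModuleCat.mono_iff_injective _).mpr hf
      epi_g := (ModuleCat.epi_iff_surjective _).mpr hg }
  refine ⟨fun x y => sub_eq_zero.mp ?_⟩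
  obtain ⟨z, hz⟩ := Ext.covariant_sequence_exact₂ N hS (x - y)
    (Subsingleton.elim (α := Ext N (ModuleCat.of R M₃) i) _ _)
  rw [← hz, Subsingleton.elim (α := Ext N (ModuleCat.of R M₁) i) z 0]
  exact Ext.zero_comp N _ (Ext.mk₀ S.f) i (add_zero i)

/-- Vanishing of `Ext` for `R ⧸ I` follows from that for `R ⧸ J` and `R ⧸ (I + (f))`, if `J` is
the colon ideal of `I` by `f`. -/
theorem ModuleCat.subsingleton_ext_quotient_of_colon {R : Type w} [CommRing R] (N : ModuleCat.{w} R)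
    (I J : Ideal R) (f : R) (hJ : ∀ x, x ∈ J ↔ x * f ∈ I) (i : ℕ)
    (h₁ : Subsingleton (Ext N (ModuleCat.of R (R ⧸ J)) i))
    (h₃ : Subsingleton (Ext N (ModuleCat.of R (R ⧸ (I ⊔ Ideal.span {f}))) i)) :
    Subsingleton (Ext N (ModuleCat.of R (R ⧸ I)) i) := by
  refine ModuleCat.subsingleton_ext_of_exact N
    (Submodule.liftQ J ((Submodule.mkQ I) ∘ₗ LinearMap.mulRight R f) ?_)
    (Submodule.factor (le_sup_left : I ≤ I ⊔ Ideal.span {f})) ?_ ?_ ?_ i h₁ h₃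
  · intro x hx
    simpa using (Submodule.Quotient.mk_eq_zero I).mpr ((hJ x).mp hx)
  · rw [← LinearMap.ker_eq_bot, Submodule.ker_liftQ_eq_bot]
    intro x hx
    exact (hJ x).mpr ((Submodule.Quotient.mk_eq_zero I).mp (by simpa using hx))
  · exact Submodule.factor_surjective _
  · intro y
    obtain ⟨y, rfl⟩ := Submodule.mkQ_surjective I y
    constructor
    · intro hy
      have hy : y ∈ I ⊔ Ideal.span {f} := (Submodule.Quotient.mk_eq_zero _).mp (by simpa using hy)
      obtain ⟨a, ha, b, hb, rfl⟩ := Submodule.mem_sup.mp hy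
      obtain ⟨c, rfl⟩ := Ideal.mem_span_singleton'.mp hb
      refine ⟨Submodule.Quotient.mk c, ?_⟩
      refine (Submodule.Quotient.eq I).mpr ?_
      simpa using ha
    · rintro ⟨x, hx⟩
      obtain ⟨x, rfl⟩ := Submodule.mkQ_surjective J x
      rw [← hx]
      refine (Submodule.Quotient.mk_eq_zero _).mpr ?_
      exact Ideal.mem_sup_right (Ideal.mul_mem_left _ _ (Ideal.mem_span_singleton_self f))

end Ext

/-! ### Face ideals and their minimal primes -/

section FaceIdeal

open MvPolynomial

variable {V : Type*}

/-- The face ideal of a simplicial complex, spanned by the monomials whose support is not a face. -/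
noncomputable def faceIdeal (K : Type*) [CommRing K] {V : Type*} (Δ : LowerSet (Finset V)) :
    Ideal (MvPolynomial V K) :=
  Ideal.span ((fun s => monomial s (1 : K)) '' {s : V →₀ ℕ | s.support ∉ Δ})

theorem mem_faceIdeal {K : Type*} [CommRing K] {Δ : LowerSet (Finset V)} {p : MvPolynomial V K} :
    p ∈ faceIdeal K Δ ↔ ∀ s ∈ p.support, s.support ∉ Δ := by
  rw [faceIdeal, mem_ideal_span_monomial_image]
  refine forall₂_congr fun s _ => ⟨?_, fun h => ⟨s, h, le_rfl⟩⟩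
  rintro ⟨t, ht, hts⟩ hs
  exact ht (Δ.lower (Finsupp.support_mono hts) hs)

theorem faceIdeal_anti {K : Type*} [CommRing K] {Δ Δ' : LowerSet (Finset V)} (h : Δ ≤ Δ') :
    faceIdeal K Δ' ≤ faceIdeal K Δ := fun _ hp =>
  mem_faceIdeal.mpr fun s hs hsΔ => mem_faceIdeal.mp hp s hs (h hsΔ)

theorem monomial_mem_faceIdeal {K : Type*} [CommRing K] {Δ : LowerSet (Finset V)} {s : V →₀ ℕ}
    (hs : s.support ∉ Δ) (c : K) : monomial s c ∈ faceIdeal K Δ :=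
  mem_faceIdeal.mpr fun t ht => by
    classical
    rwa [Finset.mem_singleton.mp (support_monomial_subset ht)]

theorem Finsupp.support_indicator_one (H : Finset V) :
    (Finsupp.indicator H fun _ _ => (1 : ℕ)).support = H := by
  classical
  ext v
  simp [Finsupp.indicator_apply]

theorem isPrime_span_X_image {K : Type*} [CommRing K] [IsDomain K] (S : Set V) :
    (Ideal.span ((fun v => (X v : MvPolynomial V K)) '' S)).IsPrime := by
  classical
  set P := Ideal.span ((fun v => (X v : MvPolynomial V K)) '' S) with hP
  -- Setting the variables of `S` to zero is an endomorphism with kernel `P`, and its target is a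
  -- domain.
  let φ : MvPolynomial V K →ₐ[K] MvPolynomial V K := aeval fun v => if v ∈ S then 0 else X v
  have h (p : MvPolynomial V K) : p - φ p ∈ P := by
    rw [← Ideal.Quotient.eq]
    suffices Ideal.Quotient.mkₐ K P = (Ideal.Quotient.mkₐ K P).comp φ from DFunLike.congr_fun this p
    ext v
    by_cases hv : v ∈ S
    · have hvP : (X v : MvPolynomial V K) ∈ P := Ideal.subset_span ⟨v, hv, rfl⟩
      simpa [φ, hv, Ideal.Quotient.eq_zero_iff_mem] using hvP
    · simp [φ, hv]
  have hker : P = RingHom.ker φ := by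
    refine le_antisymm (Ideal.span_le.mpr ?_) fun p hp => ?_
    · rintro _ ⟨v, hv, rfl⟩
      simp [φ, hv]
    · simpa [(RingHom.mem_ker).mp hp] using h p
  rw [hker]
  exact RingHom.ker_isPrime _

theorem mem_span_X_compl_iff {K : Type*} [CommRing K] [Fintype V] [DecidableEq V] {F : Finset V}
    {p : MvPolynomial V K} :
    p ∈ Ideal.span ((fun v => (X v : MvPolynomial V K)) '' ((Fᶜ : Finset V) : Set V)) ↔
      ∀ s ∈ p.support, ¬ s.support ⊆ F := by
  refine mem_ideal_span_X_image.trans (forall₂_congr fun s _ => ?_)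
  simp [Finset.not_subset, and_comm]

/-- A prime ideal containing the face ideal contains all variables outside of some face. -/
theorem filter_X_notMem_mem_of_faceIdeal_le {K : Type*} [CommRing K] [Fintype V]
    {Δ : LowerSet (Finset V)} {p : Ideal (MvPolynomial V K)} [hp : p.IsPrime]
    (h : faceIdeal K Δ ≤ p) [DecidablePred fun v => (X v : MvPolynomial V K) ∉ p] :
    Finset.univ.filter (fun v => (X v : MvPolynomial V K) ∉ p) ∈ Δ := by
  by_contra hH
  set H := Finset.univ.filter (fun v => (X v : MvPolynomial V K) ∉ p)
  have hmem : monomial (Finsupp.indicator H fun _ _ => 1) (1 : K) ∈ p :=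
    h (monomial_mem_faceIdeal (by rwa [Finsupp.support_indicator_one]) _)
  rw [monomial_eq, C_1, one_mul, Finsupp.prod, Finsupp.support_indicator_one] at hmem
  obtain ⟨v, hv, hvp⟩ := hp.prod_mem_iff.mp hmem
  exact (Finset.mem_filter.mp hv).2 (hp.mem_of_pow_mem _ hvp)

theorem exists_facet_ge [Finite V] {Δ : LowerSet (Finset V)} {H : Finset V} (hH : H ∈ Δ) :
    ∃ G ∈ simplicialFacets Δ, H ⊆ G := by
  obtain ⟨G, hG, hmax⟩ := (Set.toFinite {H | H ∈ Δ}).exists_le_maximal hH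
  exact ⟨G, hmax, hG⟩

theorem stanleyReisnerComplex_faceIdeal {K : Type*} [Field K] [Fintype V] [DecidableEq V]
    (Δ : LowerSet (Finset V)) : stanleyReisnerComplex (faceIdeal K Δ) = Δ := by
  classical
  ext G
  constructor
  · rintro ⟨S, hS, hG⟩
    have := hS.1.1
    refine Δ.lower ?_ (filter_X_notMem_mem_of_faceIdeal_le hS.1.2)
    intro v hv
    refine Finset.mem_filter.mpr ⟨Finset.mem_univ v, fun hvS => ?_⟩
    obtain ⟨w, hw, hwv⟩ := mem_ideal_span_X_image.mp hvS (Finsupp.single v 1) (by simp [X])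
    have : w = v := by
      by_contra hne
      exact hwv (Finsupp.single_eq_of_ne hne)
    subst this
    exact Finset.mem_compl.mp (hG hv) hw
  · intro hG
    obtain ⟨F, hF, hGF⟩ := exists_facet_ge hG
    refine ⟨Fᶜ, ⟨⟨isPrime_span_X_image _, fun p hp => ?_⟩, fun q ⟨hq, hqI⟩ hqF => ?_⟩, by simpa⟩
    · exact mem_span_X_compl_iff.mpr fun s hs hsF =>
        mem_faceIdeal.mp hp s hs (Δ.lower hsF hF.1)
    -- For a prime `q` between the face ideal and `P_F`, the variables outside `q` form a face
    -- containing `F`; as `F` is a facet this face is `F`, so `q = P_F`.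
    · have hle : F ⊆ Finset.univ.filter (fun v => (X v : MvPolynomial V K) ∉ q) := fun v hv => by
        refine Finset.mem_filter.mpr ⟨Finset.mem_univ v, fun hvq => ?_⟩
        exact mem_span_X_compl_iff.mp (hqF hvq) (Finsupp.single v 1) (by simp [X])
          (Finsupp.support_single_subset.trans (by simpa))
      have := hF.2 (filter_X_notMem_mem_of_faceIdeal_le hqI) hle
      rw [Ideal.span_le]
      rintro _ ⟨v, hv, rfl⟩
      by_contra hvq
      exact Finset.mem_compl.mp hv (this (Finset.mem_filter.mpr ⟨Finset.mem_univ v, hvq⟩))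

end FaceIdeal

/-! ### Consequences of the shelling condition -/

section Shelling

variable {V ι : Type*} [LinearOrder ι] {Δ : LowerSet (Finset V)} {F : ι → Finset V}

theorem IsShelling.mem_iff [Finite V] (h : IsShelling Δ F) {H : Finset V} :
    H ∈ Δ ↔ ∃ i, H ⊆ F i := by
  constructor
  · intro hH
    obtain ⟨G, hG, hHG⟩ := exists_facet_ge hH
    rw [← h.range_eq] at hG
    obtain ⟨i, rfl⟩ := hG
    exact ⟨i, hHG⟩
  · rintro ⟨i, hi⟩
    have : F i ∈ simplicialFacets Δ := h.range_eq ▸ Set.mem_range_self i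
    exact Δ.lower hi this.1

/-- The faces of `F j` that are not faces of an earlier facet are those that contain the
restriction of `F j`. -/
theorem IsShelling.exists_restriction (h : IsShelling Δ F) (j : ι) :
    ∃ G ⊆ F j, ∀ H ⊆ F j, (∀ i < j, ¬ H ⊆ F i) ↔ G ⊆ H := by
  by_cases hj : ∃ i, i < j
  · obtain ⟨G, hG, huniq⟩ := h.existsUnique_minimal j hj
    refine ⟨G, hG.1.1, fun H hH => ⟨fun hnew => ?_, fun hGH i hi hHi => hG.1.2 i hi (hGH.trans hHi)⟩⟩
    obtain ⟨G', hG', hmin⟩ := Set.Finite.exists_le_minimal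
      (s := {H' | H' ⊆ F j ∧ ∀ i, i < j → ¬ H' ⊆ F i})
      ((F j).powerset.finite_toSet.subset fun H' hH' => Finset.mem_powerset.mpr hH'.1)
      (a := H) ⟨hH, hnew⟩
    rw [← huniq G' hmin]
    exact hG'
  -- At the first index every face is new, so the restriction is empty.
  · exact ⟨∅, by simp, fun H _ => ⟨fun _ => by simp, fun _ i hi => (hj ⟨i, hi⟩).elim⟩⟩

theorem IsShelling.comp_orderIso {κ : Type*} [LinearOrder κ] (h : IsShelling Δ F) (e : κ ≃o ι) :
    IsShelling Δ (F ∘ e) where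
  injective := h.injective.comp e.injective
  range_eq := by rw [e.surjective.range_comp, h.range_eq]
  pure i j := h.pure _ _
  existsUnique_minimal j := by
    rintro ⟨i, hi⟩
    have := h.existsUnique_minimal (e j) ⟨e i, e.lt_iff_lt.mpr hi⟩
    have key (H : Finset V) : (∀ i, i < e j → ¬ H ⊆ F i) ↔ ∀ i, i < j → ¬ H ⊆ (F ∘ e) i :=
      ⟨fun hH i hi => hH _ (e.lt_iff_lt.mpr hi), fun hH i hi => by
        simpa using hH (e.symm i) (by simpa [e.symm_apply_lt] using hi)⟩
    simp only [key] at this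
    exact this

theorem IsShelling.isShellable [Fintype ι] (h : IsShelling Δ F) : IsShellable Δ :=
  ⟨Fintype.card ι, _, h.comp_orderIso (Fintype.orderIsoFinOfCardEq ι rfl)⟩

end Shelling

/-! ### Adding one facet at a time -/

section Filtration

open MvPolynomial

/-- The complex generated by the first `k` members of a finite family. -/
def initialComplex {V : Type*} {q : ℕ} (F : Fin q → Finset V) (k : ℕ) : LowerSet (Finset V) where
  carrier := {H | ∃ i : Fin q, i.val < k ∧ H ⊆ F i}
  lower' := fun _ _ hle ⟨i, hi, hF⟩ => ⟨i, hi, hle.trans hF⟩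

/-- Take for `f` the squarefree monomial of the restriction `G`. The faces gained with `F j` are
those between `G` and `F j`, so `f` kills exactly the monomials not supported in `F j`, and
adjoining `f` removes exactly the new faces. -/
theorem IsShelling.exists_colon {V : Type*} [Fintype V] [DecidableEq V] (K : Type*) [CommRing K]
    {Δ : LowerSet (Finset V)} {q : ℕ}
    {F : Fin q → Finset V} (h : IsShelling Δ F) (j : Fin q) :
    ∃ f : MvPolynomial V K,
      (∀ x, x ∈ Ideal.span ((fun v => (X v : MvPolynomial V K)) '' (((F j)ᶜ : Finset V) : Set V)) ↔
        x * f ∈ faceIdeal K (initialComplex F (j + 1))) ∧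
      faceIdeal K (initialComplex F (j + 1)) ⊔ Ideal.span {f} =
        faceIdeal K (initialComplex F j) := by
  obtain ⟨G, hGF, hG⟩ := h.exists_restriction j
  let g : V →₀ ℕ := Finsupp.indicator G fun _ _ => 1
  have hg : g.support = G := Finsupp.support_indicator_one G
  have hnew {H : Finset V} (hH : G ⊆ H) (i : Fin q) (hi : i.val < j) : ¬ H ⊆ F i := fun hHi =>
    (hG G hGF).mpr le_rfl i hi (hH.trans hHi)
  refine ⟨monomial g 1, fun x => ?_, le_antisymm (sup_le ?_ ?_) fun p hp => ?_⟩
  · have hsupp (s : V →₀ ℕ) : (s + g).support = s.support ∪ G := by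
      rw [← hg]
      ext v
      simp [or_iff_not_imp_left]
    rw [mem_span_X_compl_iff, mem_faceIdeal]
    constructor
    · rintro hx t ht ⟨i, hi, hti⟩
      rw [mem_support_iff, coeff_mul_monomial', ne_eq, ite_eq_right_iff, mul_one,
        Classical.not_imp] at ht
      obtain ⟨s, rfl⟩ := exists_add_of_le ht.1
      rw [add_comm, hsupp] at hti
      rw [add_tsub_cancel_left] at ht
      rcases (Nat.lt_succ_iff.mp hi).lt_or_eq with hi | hi
      · exact hnew Finset.subset_union_right i hi hti
      · obtain rfl := Fin.ext hi
        exact hx s (mem_support_iff.mpr ht.2) (Finset.subset_union_left.trans hti)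
    · intro hx s hs hsF
      refine hx (s + g) ?_ ⟨j, Nat.lt_succ_self _, ?_⟩
      · rwa [mem_support_iff, coeff_mul_monomial, mul_one, ← mem_support_iff]
      · rw [hsupp]
        exact Finset.union_subset hsF hGF
  · refine faceIdeal_anti ?_
    rintro H ⟨i, hi, hH⟩
    exact ⟨i, hi.trans (Nat.lt_succ_self _), hH⟩
  · rw [Ideal.span_singleton_le_iff_mem]
    refine monomial_mem_faceIdeal ?_ _
    rintro ⟨i, hi, hH⟩
    exact hnew hg.ge i hi hH
  · rw [p.as_sum]
    refine Ideal.sum_mem _ fun s hs => ?_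
    have hsj := mem_faceIdeal.mp hp s hs
    by_cases hs' : s.support ∈ initialComplex F (j + 1)
    · obtain ⟨i, hi, hsi⟩ := hs'
      have hij : i = j := by
        by_contra hne
        exact hsj ⟨i, lt_of_le_of_ne (Nat.lt_succ_iff.mp hi) (fun e => hne (Fin.ext e)), hsi⟩
      subst hij
      have hGs : G ⊆ s.support := (hG _ hsi).mp fun l hl hsl => hsj ⟨l, hl, hsl⟩
      refine Ideal.mem_sup_right (Ideal.mem_span_singleton.mpr ?_)
      refine (monomial_dvd_monomial).mpr ⟨Or.inr fun v => ?_, one_dvd _⟩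
      by_cases hv : v ∈ G
      · have := Finsupp.mem_support_iff.mp (hGs hv)
        simp [g, hv]
        omega
      · simp [g, hv]
    · exact Ideal.mem_sup_left (monomial_mem_faceIdeal hs' _)

end Filtration

/-! ### Shellable implies Cohen–Macaulay -/

section CohenMacaulay

open MvPolynomial CategoryTheory Abelian RingTheory.Sequence

theorem IsShelling.subsingleton_ext {K V : Type*} [Field K] [Fintype V] [DecidableEq V]
    {Δ : LowerSet (Finset V)} {q : ℕ} {F : Fin q → Finset V} (h : IsShelling Δ F) {d : ℕ}
    (hd : ∀ j, (F j).card = d) (m : Ideal (MvPolynomial V K)) [m.IsMaximal] (i : ℕ) (hi : i < d) :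
    Subsingleton (Ext (ModuleCat.of (MvPolynomial V K) (MvPolynomial V K ⧸ m))
      (ModuleCat.of (MvPolynomial V K) (MvPolynomial V K ⧸ faceIdeal K Δ)) i) := by
  -- By the Nullstellensatz the residue field is finite over `K`, so minimal polynomials of the
  -- variables give monic elements of `m`, even when `m` is not a rational point.
  let P (v : V) : Polynomial K := minpoly K (Ideal.Quotient.mk m (X v))
  let := Ideal.Quotient.field m
  have hfin : Module.Finite K (MvPolynomial V K ⧸ m) :=
    finite_of_finite_type_of_isJacobsonRing _ _
  have hP (v : V) : (P v).Monic := minpoly.monic (Algebra.IsIntegral.isIntegral _)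
  have hPm (v : V) : Polynomial.aeval (X v : MvPolynomial V K) (P v) ∈ m := by
    rw [← Ideal.Quotient.eq_zero_iff_mem, ← Ideal.Quotient.mkₐ_eq_mk K,
      ← Polynomial.aeval_algHom_apply]
    exact minpoly.aeval _ _
  have key (k : ℕ) (hk : k ≤ q) :
      Subsingleton (Ext (ModuleCat.of (MvPolynomial V K) (MvPolynomial V K ⧸ m))
        (ModuleCat.of (MvPolynomial V K)
          (MvPolynomial V K ⧸ faceIdeal K (initialComplex F k))) i) := by
    induction k with
    | zero =>
      -- With no facets even the empty set is not a face, so the quotient is zero, and a sequence of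
      -- zeros of any length is weakly regular on it.
      have htop : faceIdeal K (initialComplex F 0) = ⊤ := by
        refine (Ideal.eq_top_iff_one _).mpr (mem_faceIdeal.mpr ?_)
        rintro s - ⟨j, hj, -⟩
        exact Nat.not_lt_zero _ hj
      have : Subsingleton (MvPolynomial V K ⧸ faceIdeal K (initialComplex F 0)) :=
        Ideal.Quotient.subsingleton_iff.mpr htop
      exact (ModuleCat.subsingleton_ext_of_isWeaklyRegular m _ (Ideal.annihilator_quotient).ge _
        (List.replicate (i + 1) 0) (by simp +contextual)
        ⟨fun _ _ => (fun _ _ _ => Subsingleton.elim _ _)⟩) i (by simp)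
    | succ k ih =>
      obtain ⟨f, hf, hsup⟩ := h.exists_colon K ⟨k, hk⟩
      refine ModuleCat.subsingleton_ext_quotient_of_colon _ _ _ f hf i ?_ ?_
      · refine ModuleCat.subsingleton_ext_of_isWeaklyRegular m _ (Ideal.annihilator_quotient).ge _ _
          ?_ (isWeaklyRegular_quotient_span_X (F ⟨k, hk⟩) P hP) i ?_
        · intro r hr
          obtain ⟨v, -, rfl⟩ := List.mem_map.mp hr
          exact hPm v
        · simpa [hd] using hi
      · rw [hsup]
        exact ih (Nat.le_of_succ_le hk)
  have hΔ : initialComplex F q = Δ := by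
    ext H
    refine Iff.trans ?_ h.mem_iff.symm
    exact ⟨fun ⟨j, _, hj⟩ => ⟨j, hj⟩, fun ⟨j, hj⟩ => ⟨j, j.2, hj⟩⟩
  exact hΔ ▸ key q le_rfl

/-- The chains of primes over the face ideal are chains of primes over the ideal of one facet. -/
theorem ringKrullDim_quotient_faceIdeal_le {K V : Type*} [Field K] [Fintype V]
    {Δ : LowerSet (Finset V)} {d : ℕ} (hd : ∀ H ∈ Δ, H.card ≤ d) :
    ringKrullDim (MvPolynomial V K ⧸ faceIdeal K Δ) ≤ d := by
  classical
  rw [ringKrullDim_quotient]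
  refine iSup_le fun l => ?_
  -- The variables in the smallest prime of the chain generate `J`, and the remaining ones form a
  -- face `H`; the chain lives in `R/J`, a quotient of the polynomial ring on `H`.
  let p : Ideal (MvPolynomial V K) := l.head.1.asIdeal
  have hp : p.IsPrime := l.head.1.isPrime
  have hH := filter_X_notMem_mem_of_faceIdeal_le (p := p) l.head.2
  set H := Finset.univ.filter fun v => (X v : MvPolynomial V K) ∉ p
  let J := Ideal.span ((fun v => (X v : MvPolynomial V K)) '' ((Hᶜ : Finset V) : Set V))
  have hJ : J ≤ p := by
    rw [Ideal.span_le]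
    rintro _ ⟨v, hv, rfl⟩
    simpa [H] using hv
  have hl (k : Fin (l.length + 1)) : J ≤ (l k).1.asIdeal :=
    hJ.trans (show l.head.1 ≤ (l k).1 from LTSeries.head_le l k)
  let l' : LTSeries (PrimeSpectrum.zeroLocus (J : Set (MvPolynomial V K))) :=
    ⟨l.length, fun k => ⟨(l k).1, hl k⟩, fun k => l.step k⟩
  have h1 : (l.length : WithBot ℕ∞) ≤ ringKrullDim (MvPolynomial V K ⧸ J) := by
    rw [ringKrullDim_quotient]
    exact le_iSup (fun l : LTSeries (PrimeSpectrum.zeroLocus (J : Set (MvPolynomial V K))) =>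
      (l.length : WithBot ℕ∞)) l'
  refine h1.trans ?_
  let ψ : MvPolynomial H K →ₐ[K] MvPolynomial V K ⧸ J :=
    (Ideal.Quotient.mkₐ K J).comp (rename ((↑) : H → V))
  have hsurj : Function.Surjective ψ.toRingHom := fun y => by
    obtain ⟨x, rfl⟩ := Ideal.Quotient.mk_surjective y
    change Ideal.Quotient.mkₐ K J x ∈ ψ.range
    induction x using MvPolynomial.induction_on with
    | C a => exact ⟨C a, by simp [ψ]⟩
    | add x y hx hy =>
      rw [map_add]
      exact add_mem hx hy
    | mul_X x v hx =>
      rw [map_mul]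
      refine mul_mem hx ?_
      by_cases hv : v ∈ H
      · exact ⟨X ⟨v, hv⟩, by simp [ψ]⟩
      · have hvJ : (X v : MvPolynomial V K) ∈ J := Ideal.subset_span ⟨v, by simpa using hv, rfl⟩
        rw [Ideal.Quotient.mkₐ_eq_mk, Ideal.Quotient.eq_zero_iff_mem.mpr hvJ]
        exact zero_mem _
  refine (ringKrullDim_le_of_surjective _ hsurj).trans ?_
  rw [MvPolynomial.ringKrullDim_of_isNoetherianRing, ringKrullDim_eq_zero_of_field, zero_add]
  simpa using hd H hH

/-- Each element of a regular sequence lowers the dimension by one and the final quotient is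
nonzero, so no regular sequence is longer than the dimension. -/
theorem localRingDepth_eq_ringKrullDim_of_isRegular {R : Type*} [CommRing R] [IsLocalRing R]
    [IsNoetherianRing R] {rs : List R} (hrs : IsRegular R rs)
    (hmem : ∀ r ∈ rs, r ∈ IsLocalRing.maximalIdeal R) (hdim : ringKrullDim R ≤ rs.length) :
    (localRingDepth R : WithBot ℕ∞) = ringKrullDim R := by
  have hle (l : List R) (hl : IsRegular R l) : (l.length : WithBot ℕ∞) ≤ ringKrullDim R := by
    rw [← ringKrullDim_add_length_eq_ringKrullDim_of_isRegular l hl]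
    have : Nontrivial (R ⧸ Ideal.ofList l) := by
      refine Ideal.Quotient.nontrivial_iff.mpr fun htop => hl.2 ?_
      rw [htop, smul_eq_mul, Ideal.top_mul]
    exact le_add_of_nonneg_left ringKrullDim_nonneg_of_nontrivial
  have hdepth : localRingDepth R = rs.length := by
    refine le_antisymm (iSup_le fun l => ?_) ?_
    · exact WithBot.coe_le_coe.mp ((hle l.1 l.2.2).trans hdim)
    · exact le_iSup (fun l : {l : List R // (∀ r ∈ l, r ∈ IsLocalRing.maximalIdeal R) ∧
        IsRegular R l} => (l.1.length : ℕ∞)) ⟨rs, hmem, hrs⟩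
  rw [hdepth]
  exact le_antisymm (hle rs hrs) hdim

/-- The Stanley–Reisner ring of a shellable complex is Cohen–Macaulay. -/
theorem IsShelling.isCohenMacaulayRing {K V : Type*} [Field K] [Fintype V]
    {Δ : LowerSet (Finset V)} {q : ℕ} {F : Fin q → Finset V} (h : IsShelling Δ F) :
    IsCohenMacaulayRing (MvPolynomial V K ⧸ faceIdeal K Δ) := by
  classical
  refine ⟨inferInstance, fun m hm => ?_⟩
  let I := faceIdeal K Δ
  let m' := m.comap (Ideal.Quotient.mk I)
  have hm' : m'.IsMaximal := Ideal.comap_isMaximal_of_surjective _ Ideal.Quotient.mk_surjective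
  have hIm : I ≤ m' := fun x hx => by
    simp [m', I, Ideal.mem_comap, Ideal.Quotient.eq_zero_iff_mem.mpr hx]
  have hface := filter_X_notMem_mem_of_faceIdeal_le (p := m') hIm
  obtain ⟨j₀, -⟩ := h.mem_iff.mp hface
  have hd (j) : (F j).card = (F j₀).card := h.pure j j₀
  set d := (F j₀).card
  have hlt : m' • (⊤ : Submodule (MvPolynomial V K) (MvPolynomial V K ⧸ I)) < ⊤ := by
    refine lt_top_iff_ne_top.mpr fun htop => hm'.ne_top ((Ideal.eq_top_iff_one _).mpr ?_)
    have h1 : (1 : MvPolynomial V K ⧸ I) ∈ m' • (⊤ : Submodule (MvPolynomial V K) _) :=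
      by rw [htop]; exact Submodule.mem_top
    have hle : m' • (⊤ : Submodule (MvPolynomial V K) (MvPolynomial V K ⧸ I)) ≤
        Submodule.map (Submodule.mkQ I) m' := by
      refine Submodule.smul_le.mpr fun r hr x _ => ?_
      obtain ⟨x, rfl⟩ := Submodule.mkQ_surjective I x
      exact ⟨r * x, m'.mul_mem_right _ hr, rfl⟩
    obtain ⟨x, hx, hx1⟩ := hle h1
    have := hIm ((Submodule.Quotient.eq I).mp (hx1 : Submodule.Quotient.mk x =
      Submodule.Quotient.mk (1 : MvPolynomial V K)))
    simpa using sub_mem hx this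
  -- Rees's theorem: vanishing of Ext below `d` yields a regular sequence of length `d` in `m'`.
  obtain ⟨rs, hlen, hmem, hreg⟩ := ModuleCat.exists_isRegular_of_exists_subsingleton_ext m' d
    (ModuleCat.of (MvPolynomial V K) (MvPolynomial V K ⧸ I)) hlt
    (ModuleCat.of (MvPolynomial V K) (MvPolynomial V K ⧸ m'))
    (by rw [Module.support_eq_zeroLocus, Ideal.annihilator_quotient])
    (h.subsingleton_ext hd m')
  have hreg' : IsWeaklyRegular (MvPolynomial V K ⧸ I) (rs.map (Ideal.Quotient.mk I)) :=
    (isWeaklyRegular_map_algebraMap_iff (R := MvPolynomial V K) (MvPolynomial V K ⧸ I)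
      (MvPolynomial V K ⧸ I) rs).mpr hreg.toIsWeaklyRegular
  have hmem' : ∀ r ∈ rs.map (Ideal.Quotient.mk I), r ∈ m := by
    simpa [m'] using hmem
  refine localRingDepth_eq_ringKrullDim_of_isRegular
    (hreg'.isRegular_of_isLocalization_of_mem (Localization.AtPrime m) m hmem') ?_ ?_
  · intro r hr
    obtain ⟨s, hs, rfl⟩ := List.mem_map.mp hr
    exact (IsLocalization.AtPrime.to_map_mem_maximal_iff _ m _).mpr (hmem' s hs)
  · rw [List.length_map, List.length_map, hlen,
      IsLocalization.AtPrime.ringKrullDim_eq_height m (Localization.AtPrime m)]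
    refine (Ideal.height_le_ringKrullDim_of_ne_top hm.ne_top).trans
      (ringKrullDim_quotient_faceIdeal_le fun H hH => ?_)
    obtain ⟨i, hi⟩ := h.mem_iff.mp hH
    exact (Finset.card_le_card hi).trans (hd i).le

end CohenMacaulay

/-! ### Facet vectors and the faces of the complex -/

section FacetVectors

variable {n : ℕ}

/-- Replaces the two shapes of vectors by one linear condition, which makes counting and exchange
uniform. -/
theorem isFacetVector_iff_sum {u : Fin n → Fin 3} :
    IsFacetVector u ↔ ∑ j, (2 - (u j).val) = 3 := by
  constructor
  · rintro (⟨i, j, k, hij, hik, hjk, hi, hj, hk, h⟩ | ⟨i, j, hij, hi, hj, h⟩)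
    · rw [← Finset.sum_subset (Finset.subset_univ {i, j, k})]
      · simp [hij, hik, hjk, hi, hj, hk]
      · intro l _ hl
        simp only [Finset.mem_insert, Finset.mem_singleton, not_or] at hl
        simp [h l hl.1 hl.2.1 hl.2.2]
    · rw [← Finset.sum_subset (Finset.subset_univ {i, j})]
      · simp [hij, hi, hj]
      · intro l _ hl
        simp only [Finset.mem_insert, Finset.mem_singleton, not_or] at hl
        simp [h l hl.1 hl.2]
  · intro h
    by_cases h0 : ∃ i, u i = 0
    · obtain ⟨i, hi⟩ := h0
      rw [← Finset.add_sum_erase _ _ (Finset.mem_univ i), hi] at h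
      have h1 : ∑ l ∈ Finset.univ.erase i, (2 - (u l).val) = 1 := by
        rw [Fin.val_zero] at h
        omega
      obtain ⟨j, hj, hj0⟩ := Finset.exists_ne_zero_of_sum_ne_zero (h1.trans_ne one_ne_zero)
      rw [← Finset.add_sum_erase _ _ hj] at h1
      have hrest : ∑ l ∈ (Finset.univ.erase i).erase j, (2 - (u l).val) = 0 := by omega
      rw [Finset.sum_eq_zero_iff] at hrest
      refine Or.inr ⟨i, j, (Finset.ne_of_mem_erase hj).symm, hi, by omega, fun l hli hlj => ?_⟩
      have := hrest l (by simp [hli, hlj])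
      omega
    · push Not at h0
      have h1 (l : Fin n) : 2 - (u l).val = if u l = 1 then 1 else 0 := by
        have := h0 l
        split_ifs <;> omega
      simp only [h1, Finset.sum_boole, Nat.cast_id] at h
      obtain ⟨i, j, k, hij, hik, hjk, hs⟩ := Finset.card_eq_three.mp h
      have hs (l : Fin n) : u l = 1 ↔ l = i ∨ l = j ∨ l = k := by
        simpa using Finset.ext_iff.mp hs l
      refine Or.inl ⟨i, j, k, hij, hik, hjk, by simp [hs], by simp [hs], by simp [hs],
        fun l hi hj hk => ?_⟩
      have h2 := mt (hs l).mp (by simp [hi, hj, hk])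
      have := h0 l
      omega

theorem mem_facetSet {u : Fin n → Fin 3} {p : Fin 3 × Fin n} : p ∈ facetSet u ↔ u p.2 ≤ p.1 := by
  simp [facetSet]

theorem facetSet_injective : Function.Injective (facetSet (n := n)) := fun u v h => by
  funext j
  have h (i : Fin 3) : u j ≤ i ↔ v j ≤ i := by
    simpa [mem_facetSet] using Finset.ext_iff.mp h (i, j)
  exact le_antisymm ((h _).mpr le_rfl) ((h _).mp le_rfl)

theorem card_facetSet {u : Fin n → Fin 3} (hu : IsFacetVector u) : (facetSet u).card = n + 3 := by
  -- A column contributes its `z` and one more variable per unit of deficit.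
  have h1 : ∀ a : Fin 3, (∑ i : Fin 3, if a ≤ i then 1 else 0) = 1 + (2 - a.val) := by decide
  rw [facetSet, Finset.card_filter, Fintype.sum_prod_type_right]
  simp only [h1, Finset.sum_add_distrib, isFacetVector_iff_sum.mp hu]
  simp

theorem subset_facetSet_iff {u : Fin n → Fin 3} {H : Finset (Fin 3 × Fin n)} :
    H ⊆ facetSet u ↔ ∀ j, ((0, j) ∈ H → u j = 0) ∧ ((1, j) ∈ H → u j ≤ 1) := by
  constructor
  · intro h j
    exact ⟨fun h0 => Fin.le_zero_iff.mp (mem_facetSet.mp (h h0)), fun h1 => mem_facetSet.mp (h h1)⟩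
  · rintro h ⟨i, j⟩ hij
    rw [mem_facetSet]
    obtain ⟨h0, h1⟩ := h j
    fin_cases i
    · exact (h0 hij).le
    · exact h1 hij
    · exact Fin.le_last (n := 2) _

/-- The complex whose facets are the sets `F_u`. -/
def facetComplex (n : ℕ) : LowerSet (Finset (Fin 3 × Fin n)) where
  carrier := {H | ∃ u, IsFacetVector u ∧ H ⊆ facetSet u}
  lower' := fun _ _ hle ⟨u, hu, h⟩ => ⟨u, hu, hle.trans h⟩

theorem simplicialFacets_facetComplex :
    simplicialFacets (facetComplex n) = {G | ∃ u, IsFacetVector u ∧ facetSet u = G} := by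
  ext G
  constructor
  · rintro ⟨⟨u, hu, hG⟩, hmax⟩
    exact ⟨u, hu, (hmax ⟨u, hu, subset_rfl⟩ hG).antisymm hG⟩
  · rintro ⟨u, hu, rfl⟩
    refine ⟨⟨u, hu, subset_rfl⟩, ?_⟩
    rintro H ⟨v, hv, hH⟩ hle
    have := Finset.eq_of_subset_of_card_le (hle.trans hH) (by rw [card_facetSet hu, card_facetSet hv])
    rwa [this]

/-- The faces of the complex are the sets that contain the variables of no generator of `M_n`. -/
theorem notMem_facetComplex_iff (hn : 2 ≤ n) {H : Finset (Fin 3 × Fin n)} :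
    H ∉ facetComplex n ↔
      (∃ i j, i ≠ j ∧ {(0, i), (0, j)} ⊆ H) ∨
      (∃ i j k, i ≠ j ∧ i ≠ k ∧ j ≠ k ∧ {(0, i), (1, j), (1, k)} ⊆ H) ∨
      (∃ i j k l, i ≠ j ∧ i ≠ k ∧ i ≠ l ∧ j ≠ k ∧ j ≠ l ∧ k ≠ l ∧
        {(1, i), (1, j), (1, k), (1, l)} ⊆ H) := by
  simp only [Finset.insert_subset_iff, Finset.singleton_subset_iff]
  constructor
  · intro hH
    by_contra! hcon
    obtain ⟨hxx, hxyy, hyyyy⟩ := hcon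
    refine hH ?_
    by_cases hx : ∃ i, ((0 : Fin 3), i) ∈ H
    · obtain ⟨i, hi⟩ := hx
      have hk : ∃ k, k ≠ i ∧ ∀ l, l ≠ i → l ≠ k → ((1 : Fin 3), l) ∉ H := by
        by_cases hy : ∃ k, k ≠ i ∧ ((1 : Fin 3), k) ∈ H
        · obtain ⟨k, hki, hk⟩ := hy
          exact ⟨k, hki, fun l hli hlk => hxyy i k l hki.symm hli.symm hlk.symm hi hk⟩
        · push Not at hy
          have : Nontrivial (Fin n) := Fin.nontrivial_iff_two_le.mpr hn
          obtain ⟨k, hk⟩ := exists_ne i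
          exact ⟨k, hk, fun l hli _ => hy l hli⟩
      obtain ⟨k, hki, hk⟩ := hk
      refine ⟨fun l => if l = i then 0 else if l = k then 1 else 2,
        Or.inr ⟨i, k, hki.symm, by simp, by simp [hki], fun l hli hlk => by simp [hli, hlk]⟩,
        subset_facetSet_iff.mpr fun l => ⟨fun hl => ?_, fun hl => ?_⟩⟩
      · have : l = i := by
          by_contra hne
          exact hxx i l (Ne.symm hne) hi hl
        simp [this]
      · by_cases hli : l = i
        · simp [hli]
        · have : l = k := by
            by_contra hne
            exact hk l hli hne hl
          simp [this, hki]
    · push Not at hx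
      let Y := Finset.univ.filter fun l => ((1 : Fin 3), l) ∈ H
      have hY : Y.card ≤ 3 := by
        by_contra! hlt
        obtain ⟨Z, hZY, hZ⟩ := Finset.exists_subset_card_eq (show 4 ≤ Y.card from hlt)
        obtain ⟨i, Z', hi, rfl, hZ'⟩ := Finset.card_eq_succ.mp hZ
        obtain ⟨j, k, l, hjk, hjl, hkl, rfl⟩ := Finset.card_eq_three.mp hZ'
        simp only [Finset.mem_insert, Finset.mem_singleton, not_or] at hi
        have hmem (t) (ht : t ∈ ({i, j, k, l} : Finset (Fin n))) : ((1 : Fin 3), t) ∈ H := by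
          simpa [Y] using hZY ht
        exact hyyyy i j k l hi.1 hi.2.1 hi.2.2 hjk hjl hkl (hmem i (by simp)) (hmem j (by simp))
          (hmem k (by simp)) (hmem l (by simp))
      -- For `n = 2` there are no three indices to carry a 1, so the vector `(0, 1)` serves.
      rcases hn.eq_or_lt with rfl | hn
      · exact ⟨![0, 1], Or.inr ⟨0, 1, by simp, rfl, rfl, fun l h0 h1 => by omega⟩,
          subset_facetSet_iff.mpr fun l => ⟨fun hl => (hx l hl).elim, fun _ => by
            fin_cases l <;> simp⟩⟩
      · obtain ⟨Z, hYZ, hZ⟩ := Finset.exists_superset_card_eq hY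
          (show 3 ≤ Fintype.card (Fin n) by rw [Fintype.card_fin]; exact hn)
        obtain ⟨i, j, k, hij, hik, hjk, rfl⟩ := Finset.card_eq_three.mp hZ
        refine ⟨fun l => if l ∈ ({i, j, k} : Finset (Fin n)) then 1 else 2,
          Or.inl ⟨i, j, k, hij, hik, hjk, by simp, by simp, by simp, fun l hi hj hk => by
            simp [hi, hj, hk]⟩,
          subset_facetSet_iff.mpr fun l => ⟨fun hl => (hx l hl).elim, fun hl => ?_⟩⟩
        rw [if_pos (hYZ (by simpa [Y] using hl))]
  -- Each type of generator forces deficit at least 4, against a total of 3.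
  · intro h
    rintro ⟨u, hu, hH⟩
    rw [isFacetVector_iff_sum] at hu
    rw [subset_facetSet_iff] at hH
    have hle (s : Finset (Fin n)) : ∑ j ∈ s, (2 - (u j).val) ≤ 3 :=
      (Finset.sum_le_sum_of_subset (Finset.subset_univ s)).trans hu.le
    rcases h with ⟨i, j, hij, hi, hj⟩ | ⟨i, j, k, hij, hik, hjk, hi, hj, hk⟩ |
      ⟨i, j, k, l, hij, hik, hil, hjk, hjl, hkl, hi, hj, hk, hl⟩
    · have := hle {i, j}
      have hi := (hH i).1 hi
      have hj := (hH j).1 hj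
      simp [hij, hi, hj] at this
    · have := hle {i, j, k}
      have hi := (hH i).1 hi
      have hj := (hH j).2 hj
      have hk := (hH k).2 hk
      rw [Finset.sum_insert (by simp [hij, hik]), Finset.sum_pair hjk] at this
      omega
    · have := hle {i, j, k, l}
      have hi := (hH i).2 hi
      have hj := (hH j).2 hj
      have hk := (hH k).2 hk
      have hl := (hH l).2 hl
      rw [Finset.sum_insert (by simp [hij, hik, hil]), Finset.sum_insert (by simp [hjk, hjl]),
        Finset.sum_pair hkl] at this
      omega

end FacetVectors

/-! ### The exchange argument and the lexicographic shelling -/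

section Exchange

variable {n : ℕ}

/-- Moving one unit from the coordinate `j` to the coordinate `k` preserves facet vectors. -/
theorem IsFacetVector.exists_exchange {u : Fin n → Fin 3} (hu : IsFacetVector u) {j k : Fin n}
    (hjk : j ≠ k) (hj : 0 < u j) (hk : u k ≤ 1) :
    ∃ v, IsFacetVector v ∧ v j < u j ∧ (v k).val = (u k).val + 1 ∧
      ∀ l, l ≠ j → l ≠ k → v l = u l := by
  let v : Fin n → Fin 3 := fun l =>
    if l = j then ⟨(u j).val - 1, by omega⟩ else if l = k then ⟨(u k).val + 1, by omega⟩ else u l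
  have hvj : (v j).val = (u j).val - 1 := by simp [v]
  have hvk : (v k).val = (u k).val + 1 := by simp [v, hjk.symm]
  have hv (l) (h1 : l ≠ j) (h2 : l ≠ k) : v l = u l := by simp [v, h1, h2]
  refine ⟨v, ?_, by omega, hvk, hv⟩
  rw [isFacetVector_iff_sum] at hu ⊢
  have hk' : k ∈ Finset.univ.erase j := by simpa using hjk.symm
  rw [← Finset.add_sum_erase _ _ (Finset.mem_univ j), ← Finset.add_sum_erase _ _ hk'] at hu ⊢
  have hrest : ∑ l ∈ (Finset.univ.erase j).erase k, (2 - (v l).val) =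
      ∑ l ∈ (Finset.univ.erase j).erase k, (2 - (u l).val) :=
    Finset.sum_congr rfl fun l hl => by
      rw [Finset.mem_erase, Finset.mem_erase] at hl
      rw [hv l hl.2.1 hl.1]
  rw [hrest]
  omega

/-- Deficits are equal in total, so a surplus of `v` at the first difference must be compensated
later. -/
theorem IsFacetVector.exists_lt_of_first_lt {u v : Fin n → Fin 3} (hu : IsFacetVector u)
    (hv : IsFacetVector v) {j : Fin n} (heq : ∀ l < j, v l = u l) (hj : v j < u j) :
    ∃ k, j < k ∧ u k < v k := by
  by_contra! hcon
  rw [isFacetVector_iff_sum] at hu hv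
  refine (Finset.sum_lt_sum (f := fun l => 2 - (u l).val) (g := fun l => 2 - (v l).val)
    (s := Finset.univ) (fun l _ => ?_) ⟨j, Finset.mem_univ j, ?_⟩).ne (hu.trans hv.symm)
  · rcases lt_trichotomy l j with h | rfl | h
    · rw [heq l h]
    · omega
    · have := hcon l h
      omega
  · omega

/-- The variables of `F_u` that can be exchanged against an earlier facet. -/
def facetRestriction (u : Fin n → Fin 3) : Finset (Fin 3 × Fin n) :=
  Finset.univ.filter fun p => p.1 = u p.2 ∧ u p.2 ≤ 1 ∧ ∃ j < p.2, 0 < u j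

theorem facetRestriction_subset_iff (u : FacetIndex n) {H : Finset (Fin 3 × Fin n)}
    (hH : H ⊆ facetSet (ofLex u.1)) :
    facetRestriction (ofLex u.1) ⊆ H ↔ ∀ v : FacetIndex n, v < u → ¬ H ⊆ facetSet (ofLex v.1) := by
  constructor
  · rintro hR v ⟨j, heq, hj⟩ hHv
    obtain ⟨k, hjk, hk⟩ := u.2.exists_lt_of_first_lt v.2 heq hj
    have hk1 : ofLex u.1 k ≤ 1 := by omega
    have : (ofLex u.1 k, k) ∈ H :=
      hR (Finset.mem_filter.mpr ⟨Finset.mem_univ _, rfl, hk1, j, hjk, (Fin.zero_le _).trans_lt hj⟩)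
    exact absurd (mem_facetSet.mp (hHv this)) (not_le.mpr hk)
  · rintro h ⟨i, k⟩ hp
    simp only [facetRestriction, Finset.mem_filter, Finset.mem_univ, true_and] at hp
    obtain ⟨rfl, hk, j, hjk, hj⟩ := hp
    by_contra hpH
    obtain ⟨v, hv, hvj, hvk, hrest⟩ := u.2.exists_exchange hjk.ne hj hk
    refine h ⟨toLex v, hv⟩ ⟨j, fun l hl => hrest l hl.ne (hl.trans hjk).ne, hvj⟩ ?_
    -- Passing from `F_u` to `F_v` loses only the variable in row `u k` of column `k`, which is not
    -- in `H`.
    rintro ⟨i, l⟩ hil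
    have hmem := mem_facetSet.mp (hH hil)
    rw [mem_facetSet]
    dsimp only at hmem ⊢
    change v l ≤ i
    by_cases hlj : l = j
    · subst hlj
      exact hvj.le.trans hmem
    · by_cases hlk : l = k
      · subst hlk
        have : i ≠ ofLex u.1 l := by
          rintro rfl
          exact hpH hil
        omega
      · rwa [hrest l hlj hlk]

theorem isShelling_facetComplex (n : ℕ) :
    IsShelling (facetComplex n) (fun u : FacetIndex n => facetSet (ofLex u.1)) where
  injective u v h := Subtype.ext (facetSet_injective h)
  range_eq := by
    rw [simplicialFacets_facetComplex]
    ext G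
    exact ⟨fun ⟨u, hu⟩ => ⟨_, u.2, hu⟩, fun ⟨u, hu, hG⟩ => ⟨⟨toLex u, hu⟩, hG⟩⟩
  pure u v := by rw [card_facetSet u.2, card_facetSet v.2]
  existsUnique_minimal u _ := by
    have hRu : facetRestriction (ofLex u.1) ⊆ facetSet (ofLex u.1) := fun p hp => by
      simp only [facetRestriction, Finset.mem_filter, Finset.mem_univ, true_and] at hp
      exact mem_facetSet.mpr hp.1.ge
    have hR := (facetRestriction_subset_iff u hRu).mp subset_rfl
    refine ⟨facetRestriction (ofLex u.1), ⟨⟨hRu, hR⟩, fun H hH _ =>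
      (facetRestriction_subset_iff u hH.1).mpr hH.2⟩, fun H hH => ?_⟩
    have hle := (facetRestriction_subset_iff u hH.1.1).mpr hH.1.2
    exact (hH.2 ⟨hRu, hR⟩ hle).antisymm hle

end Exchange

/-! ### `M_n` as a face ideal -/

section GenericInitialIdeal

open MvPolynomial

theorem prod_X_mem_faceIdeal {K V : Type*} [CommRing K] {Δ : LowerSet (Finset V)} {H : Finset V}
    (hH : H ∉ Δ) : ∏ v ∈ H, (X v : MvPolynomial V K) ∈ faceIdeal K Δ := by
  have h : monomial (Finsupp.indicator H fun _ _ => 1) (1 : K) ∈ faceIdeal K Δ :=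
    monomial_mem_faceIdeal (by rwa [Finsupp.support_indicator_one]) _
  rw [monomial_eq, C_1, one_mul, Finsupp.prod, Finsupp.support_indicator_one] at h
  convert h using 1
  exact Finset.prod_congr rfl fun v hv => by
    rw [Finsupp.indicator_of_mem hv, pow_one]

theorem prod_X_dvd_monomial {K V : Type*} [CommRing K] {H : Finset V} {s : V →₀ ℕ}
    (hH : H ⊆ s.support) (c : K) : ∏ v ∈ H, (X v : MvPolynomial V K) ∣ monomial s c := by
  rw [monomial_eq]
  refine Dvd.dvd.mul_left ?_ _
  exact (Finset.prod_dvd_prod_of_dvd _ _ fun v hv =>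
    dvd_pow_self _ (Finsupp.mem_support_iff.mp (hH hv))).trans (Finset.prod_dvd_prod_of_subset _ _ _ hH)

theorem genericInitialIdeal_eq_faceIdeal (K : Type*) [Field K] {n : ℕ} (hn : 2 ≤ n) :
    genericInitialIdeal K n = faceIdeal K (facetComplex n) := by
  have h2 (i j : Fin n) (hij : i ≠ j) :
      ∏ v ∈ {((0 : Fin 3), i), (0, j)}, (X v : MvPolynomial _ K) = xVar K i * xVar K j := by
    rw [Finset.prod_pair (by simpa using hij)]
    rfl
  have h3 (i j k : Fin n) (hjk : j ≠ k) :
      ∏ v ∈ {((0 : Fin 3), i), (1, j), (1, k)}, (X v : MvPolynomial _ K) =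
        xVar K i * yVar K j * yVar K k := by
    rw [Finset.prod_insert (by simp), Finset.prod_pair (by simpa using hjk), mul_assoc]
    rfl
  have h4 (i j k l : Fin n) (hij : i ≠ j) (hik : i ≠ k) (hil : i ≠ l) (hjk : j ≠ k) (hjl : j ≠ l)
      (hkl : k ≠ l) :
      ∏ v ∈ {((1 : Fin 3), i), (1, j), (1, k), (1, l)}, (X v : MvPolynomial _ K) =
        yVar K i * yVar K j * yVar K k * yVar K l := by
    rw [Finset.prod_insert (by simp [hij, hik, hil]), Finset.prod_insert (by simp [hjk, hjl]),
      Finset.prod_pair (by simpa using hkl), mul_assoc, mul_assoc]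
    rfl
  apply le_antisymm
  · refine Ideal.span_le.mpr ?_
    rintro p ((⟨i, j, hij, rfl⟩ | ⟨i, j, k, hij, hik, hjk, rfl⟩) |
      ⟨i, j, k, l, hij, hik, hil, hjk, hjl, hkl, rfl⟩)
    · rw [← h2 i j hij]
      exact prod_X_mem_faceIdeal ((notMem_facetComplex_iff hn).mpr
        (Or.inl ⟨i, j, hij, subset_rfl⟩))
    · rw [← h3 i j k hjk]
      exact prod_X_mem_faceIdeal ((notMem_facetComplex_iff hn).mpr
        (Or.inr (Or.inl ⟨i, j, k, hij, hik, hjk, subset_rfl⟩)))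
    · rw [← h4 i j k l hij hik hil hjk hjl hkl]
      exact prod_X_mem_faceIdeal ((notMem_facetComplex_iff hn).mpr
        (Or.inr (Or.inr ⟨i, j, k, l, hij, hik, hil, hjk, hjl, hkl, subset_rfl⟩)))
  · refine Ideal.span_le.mpr ?_
    rintro _ ⟨s, hs, rfl⟩
    rcases (notMem_facetComplex_iff hn).mp hs with ⟨i, j, hij, h⟩ | ⟨i, j, k, hij, hik, hjk, h⟩ |
      ⟨i, j, k, l, hij, hik, hil, hjk, hjl, hkl, h⟩
    · refine Ideal.mem_of_dvd _ (prod_X_dvd_monomial h 1) (Ideal.subset_span (Or.inl (Or.inl ?_)))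
      exact ⟨i, j, hij, h2 i j hij⟩
    · refine Ideal.mem_of_dvd _ (prod_X_dvd_monomial h 1) (Ideal.subset_span (Or.inl (Or.inr ?_)))
      exact ⟨i, j, k, hij, hik, hjk, h3 i j k hjk⟩
    · refine Ideal.mem_of_dvd _ (prod_X_dvd_monomial h 1) (Ideal.subset_span (Or.inr ?_))
      exact ⟨i, j, k, l, hij, hik, hil, hjk, hjl, hkl, h4 i j k l hij hik hil hjk hjl hkl⟩

end GenericInitialIdeal

theorem proposition3p7 (K : Type*) [Field K] (n : ℕ) (hn : 2 ≤ n) :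
    IsShelling (stanleyReisnerComplex (genericInitialIdeal K n))
        (fun u : FacetIndex n => facetSet (ofLex u.1)) ∧
      IsShellable (stanleyReisnerComplex (genericInitialIdeal K n)) ∧
      IsCohenMacaulayRing
        (MvPolynomial (Fin 3 × Fin n) K ⧸ genericInitialIdeal K n) := by
  classical
  rw [genericInitialIdeal_eq_faceIdeal K hn, stanleyReisnerComplex_faceIdeal]
  have h := isShelling_facetComplex n
  obtain ⟨q, F, hF⟩ := h.isShellable
  exact ⟨h, ⟨q, F, hF⟩, hF.isCohenMacaulayRing⟩
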